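/- Let $\Sigma_2=\{-1,+1\}^{\mathbb N}$ be the one-sided full shift with shift map $\sigma$, the product topology and its Borel $\sigma$-algebra. Let $\rho$ be the uniform law on $\{-1,+1\}$ and $\mathbb P=\rho^{\otimes\mathbb N}$. For a word $\omega=\omega_0\cdots\omega_{n-1}$ let $$H_n(\omega)=-\frac1{2n}\sum_{i,j=0}^{n-1}\omega_j\omega_i ,$$ and for $\beta>0$ let $\mu_{n,\beta}$ be the Curie--Weiss Gibbs measure on $\Sigma_2$, $$\mu_{n,\beta}(d\omega)=\frac{e^{-\beta H_n(\omega_0\cdots\omega_{n-1})}}{Z_{n,\beta}}\,\mathbb P(d\omega),\qquad Z_{n,\beta}=\frac1{2^n}\sum_{|\omega'|=n}e^{-\beta H_n(\omega')} .$$ For a continuous $\varphi:\Sigma_2\to\mathbb R$, an equilibrium state for $\varphi$ is a $\sigma$-invariant Borel probability measure attaining the supremum $\sup_\mu\{h_\mu+\int\varphi\,d\mu\}$ over all $\sigma$-invariant Borel probability measures $\mu$, where $h_\mu$ is the Kolmogorov--Sinai entropy; if there is exactly one equilibrium state for $\varphi$, it is called the dynamical Gibbs measure for $\varphi$. **Theorem.**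 Let $\beta>0$. 1. The function $\varphi_I(x)=\log(\cosh(\beta x))-\frac{\beta}{2}x^2$ attains its maximum over $[0,1]$ at a unique point $\xi_\beta$. 2. For every $b\in\mathbb R$ the function $b(\mathbf 1_{[+1]}-\mathbf 1_{[-1]})$, where $[\pm1]=\{x\in\Sigma_2: x_0=\pm1\}$, has a dynamical Gibbs measure $\widetilde\mu_b$. It is the Bernoulli product measure whose marginals give mass $e^{\pm b}/(e^b+e^{-b})$ to $\pm1$; in particular $\widetilde\mu_0=\mathbb P$. 3. As $n\to\infty$, $\mu_{n,\beta}$ converges weakly to $$\begin{cases}\widetilde\mu_0=\mathbb P & \text{if }\beta\le 1,\\[2pt] \frac12\left[\widetilde\mu_{\beta\xi_\beta}+\widetilde\mu_{-\beta\xi_\beta}\right] & \text{if }\beta>1.\end{cases}$$ -/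

import Mathlib

open MeasureTheory Filter Topology
open scoped ENNReal

/-! ### The alphabet `{-1, +1}` (the units of `ℤ`) and the one-sided full shift -/

instance Units.Int.instMeasurableSingletonClass : MeasurableSingletonClass ℤˣ where
  measurableSet_singleton u := by
    refine ⟨{(u : ℤ)}, MeasurableSet.singleton _, ?_⟩
    ext v
    simp [Units.ext_iff]

instance Units.Int.instBorelSpace : BorelSpace ℤˣ := by
  refine ⟨?_⟩
  rw [borel_eq_top_of_discrete]
  exact (MeasurableSpace.le_def.2 fun _ _ => trivial : _ ≤ ⊤).antisymm
    fun s _ => (Set.toFinite s).measurableSet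

namespace CurieWeiss

noncomputable section

/-- The full shift `{-1, +1}^ℕ`, with the product topology and its Borel σ-algebra. -/
abbrev Shift : Type := ℕ → ℤˣ

/-- The shift map `(σ x)_i = x_{i+1}`. -/
def shift (x : Shift) : Shift := fun i => x (i + 1)

/-- The cylinder `[w₀ … w_{n-1}]`. -/
def cyl {n : ℕ} (w : Fin n → ℤˣ) : Set Shift := {y | ∀ i : Fin n, y i = w i}

/-! ### Kolmogorov–Sinai entropy, pressure, equilibrium states -/

section Entropy

variable {X : Type*} [MeasurableSpace X]

/-- Shannon entropy `-∑ₐ μ(g = a) log μ(g = a)` of the finite partition into the fibres of `g`. -/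
def shannonEntropy {ι : Type*} [Fintype ι] (μ : Measure X) (g : X → ι) : ℝ :=
  ∑ a, Real.negMulLog (μ.real (g ⁻¹' {a}))

/-- The map whose fibres form the join `⋁_{i<n} T^{-i} P`, where `P` is the partition into the
fibres of `f`. -/
def itinerary {k : ℕ} (T : X → X) (f : X → Fin k) (n : ℕ) (x : X) : Fin n → Fin k :=
  fun i => f (T^[i] x)

/-- Entropy of `T` relative to the partition into the fibres of `f`: the limit of
`(1/n) H(⋁_{i<n} T^{-i} P)`, which exists by subadditivity when `T` preserves `μ`
(so that the `limsup` is the limit). -/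
def partitionEntropy {k : ℕ} (μ : Measure X) (T : X → X) (f : X → Fin k) : EReal :=
  limsup (fun n : ℕ => ((shannonEntropy μ (itinerary T f n) / n : ℝ) : EReal)) atTop

/-- The Kolmogorov–Sinai entropy: the supremum of the entropies relative to all finite measurable
partitions. -/
def ksEntropy (μ : Measure X) (T : X → X) : EReal :=
  ⨆ (k : ℕ) (f : X → Fin k) (_ : Measurable f), partitionEntropy μ T f

end Entropy

/-- The free energy `h_μ + ∫ φ dμ`. -/
def freeEnergy (φ : C(Shift, ℝ)) (μ : ProbabilityMeasure Shift) : EReal :=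
  ksEntropy (μ : Measure Shift) shift + ((∫ x, φ x ∂(μ : Measure Shift) : ℝ) : EReal)

/-- `μ` is invariant under the shift. -/
def IsShiftInvariant (μ : ProbabilityMeasure Shift) : Prop :=
  MeasurePreserving shift (μ : Measure Shift) (μ : Measure Shift)

/-- The pressure: the supremum of the free energy over the shift-invariant probabilities. -/
def pressure (φ : C(Shift, ℝ)) : EReal :=
  ⨆ (μ : ProbabilityMeasure Shift) (_ : IsShiftInvariant μ), freeEnergy φ μ

/-- An equilibrium state for `φ`: an invariant probability attaining the pressure. -/
def IsEquilibriumState (φ : C(Shift, ℝ)) (μ : ProbabilityMeasure Shift) : Prop :=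
  IsShiftInvariant μ ∧ freeEnergy φ μ = pressure φ

/-- `μ` is the dynamical Gibbs measure for `φ`: the unique equilibrium state. -/
def IsDynamicalGibbsMeasure (φ : C(Shift, ℝ)) (μ : ProbabilityMeasure Shift) : Prop :=
  IsEquilibriumState φ μ ∧ ∀ ν, IsEquilibriumState φ ν → ν = μ

theorem isClopen_cyl {n : ℕ} (w : Fin n → ℤˣ) : IsClopen (cyl w) := by
  have h : cyl w = ⋂ i : Fin n, (fun y : Shift => y i) ⁻¹' {w i} := by
    ext y; simp [cyl]
  rw [h]
  exact isClopen_iInter_of_finite fun i =>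
    (isClopen_discrete {w i}).preimage (continuous_apply (i : ℕ))

/-- The function `ψ = 1_{[+1]} - 1_{[-1]}`. -/
def psi : C(Shift, ℝ) where
  toFun x := (cyl ![1]).indicator (fun _ => 1) x - (cyl ![-1]).indicator (fun _ => 1) x
  continuous_toFun :=
    ((isClopen_cyl _).continuous_indicator continuous_const).sub
      ((isClopen_cyl _).continuous_indicator continuous_const)

/-! ### The Curie–Weiss model -/

/-- The Curie–Weiss Hamiltonian `H_n(ω) = -(1/(2n)) ∑_{i,j<n} ω_j ω_i`. -/
def hamiltonian {n : ℕ} (w : Fin n → ℤˣ) : ℝ :=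
  -(1 / (2 * (n : ℝ))) * ∑ i, ∑ j, ((w j : ℤ) : ℝ) * ((w i : ℤ) : ℝ)

/-- The law on `{-1, +1}` with weights proportional to `e^b` and `e^{-b}`. -/
def spinLaw (b : ℝ) : Measure ℤˣ :=
  ENNReal.ofReal (Real.exp b / (Real.exp b + Real.exp (-b))) • Measure.dirac 1 +
    ENNReal.ofReal (Real.exp (-b) / (Real.exp b + Real.exp (-b))) • Measure.dirac (-1)

instance isProbabilityMeasure_spinLaw (b : ℝ) : IsProbabilityMeasure (spinLaw b) := by
  refine ⟨?_⟩
  have h : 0 < Real.exp b + Real.exp (-b) := by positivity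
  simp only [spinLaw, Measure.coe_add, Measure.coe_smul, Pi.add_apply, Pi.smul_apply,
    measure_univ, smul_eq_mul, mul_one]
  rw [← ENNReal.ofReal_add (by positivity) (by positivity), ← add_div, div_self h.ne',
    ENNReal.ofReal_one]

/-- The Bernoulli (product) measure on the shift with marginals `spinLaw b`. -/
def bernoulli (b : ℝ) : ProbabilityMeasure Shift :=
  ⟨Measure.infinitePi fun _ => spinLaw b, inferInstance⟩

/-- The uniform law `ρ` on `{-1, +1}`. -/
def rho : Measure ℤˣ :=
  (2⁻¹ : ℝ≥0∞) • Measure.dirac 1 + (2⁻¹ : ℝ≥0∞) • Measure.dirac (-1)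

instance isProbabilityMeasure_rho : IsProbabilityMeasure rho := by
  refine ⟨?_⟩
  simp [rho, ENNReal.inv_two_add_inv_two]

/-- The uniform Bernoulli measure `ℙ = ρ^{⊗ℕ}`. -/
def unif : ProbabilityMeasure Shift := ⟨Measure.infinitePi fun _ => rho, inferInstance⟩

/-- The prefix `ω₀ … ω_{n-1}` of an infinite word. -/
def pre (n : ℕ) (ω : Shift) : Fin n → ℤˣ := fun i => ω i

/-- The normalization `Z_{n,β} = 2^{-n} ∑_{|w| = n} e^{-β H_n(w)}`. -/
def partitionFunction (n : ℕ) (β : ℝ) : ℝ :=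
  1 / 2 ^ n * ∑ w : Fin n → ℤˣ, Real.exp (-β * hamiltonian w)

/-- The measure `(e^{-β H_n} / Z_{n,β}) dℙ`. -/
def gibbsAux (n : ℕ) (β : ℝ) : Measure Shift :=
  (unif : Measure Shift).withDensity fun ω =>
    ENNReal.ofReal (Real.exp (-β * hamiltonian (pre n ω)) / partitionFunction n β)

theorem measurable_pre (n : ℕ) : Measurable (pre n) :=
  measurable_pi_lambda _ fun i => measurable_pi_apply (i : ℕ)

theorem rho_singleton (u : ℤˣ) : rho {u} = 2⁻¹ := by
  rcases Int.units_eq_one_or u with rfl | rfl <;> simp [rho, Set.indicator]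

theorem unif_pre (n : ℕ) (w : Fin n → ℤˣ) :
    (unif : Measure Shift) (pre n ⁻¹' {w}) = 2⁻¹ ^ n := by
  have h : pre n ⁻¹' {w} =
      Set.pi (Finset.range n : Set ℕ) (fun i => if hi : i < n then {w ⟨i, hi⟩} else Set.univ) := by
    ext y
    simp only [Set.mem_preimage, Set.mem_singleton_iff, funext_iff, pre, Set.mem_pi,
      Finset.coe_range, Set.mem_Iio]
    constructor
    · intro hy i hi
      simpa [hi] using hy ⟨i, hi⟩
    · intro hy i
      simpa [i.2] using hy i i.2
  change Measure.infinitePi (fun _ => rho) _ = _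
  rw [h, Measure.infinitePi_pi, Finset.prod_congr rfl (g := fun _ => (2⁻¹ : ℝ≥0∞))]
  · simp
  · intro i hi
    rw [dif_pos (Finset.mem_range.1 hi), rho_singleton]
  · intro i _
    exact (Set.toFinite _).measurableSet

instance isProbabilityMeasure_gibbsAux (n : ℕ) (β : ℝ) :
    IsProbabilityMeasure (gibbsAux n β) := by
  have hsum : 0 < ∑ w : Fin n → ℤˣ, Real.exp (-β * hamiltonian w) :=
    Finset.sum_pos (fun _ _ => Real.exp_pos _) Finset.univ_nonempty
  have hZ : 0 < partitionFunction n β := by unfold partitionFunction; positivity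
  refine ⟨?_⟩
  let F : (Fin n → ℤˣ) → ℝ≥0∞ := fun w =>
    ENNReal.ofReal (Real.exp (-β * hamiltonian w) / partitionFunction n β)
  have hm : ∀ w : Fin n → ℤˣ,
      ((unif : Measure Shift).map (pre n)) {w} = ENNReal.ofReal (1 / 2 ^ n) := by
    intro w
    rw [Measure.map_apply (measurable_pre n) (MeasurableSet.singleton w), unif_pre,
      one_div, ENNReal.ofReal_inv_of_pos (by positivity),
      ENNReal.ofReal_pow (by norm_num), ENNReal.inv_pow]
    simp
  calc gibbsAux n β Set.univ = ∫⁻ ω, F (pre n ω) ∂(unif : Measure Shift) := by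
        rw [gibbsAux, withDensity_apply _ MeasurableSet.univ, Measure.restrict_univ]
    _ = ∫⁻ w, F w ∂((unif : Measure Shift).map (pre n)) :=
        (lintegral_map (measurable_of_finite F) (measurable_pre n)).symm
    _ = ∑ w, F w * ENNReal.ofReal (1 / 2 ^ n) := by
        rw [lintegral_fintype]
        exact Finset.sum_congr rfl fun w _ => by rw [hm]
    _ = 1 := by
        simp only [F]
        simp_rw [← ENNReal.ofReal_mul (div_nonneg (Real.exp_pos _).le hZ.le)]
        rw [← ENNReal.ofReal_sum_of_nonneg fun w _ =>
          mul_nonneg (div_nonneg (Real.exp_pos _).le hZ.le) (by positivity)]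
        rw [← Finset.sum_mul, ← Finset.sum_div, partitionFunction, ENNReal.ofReal_eq_one]
        field_simp

/-- The probabilistic Gibbs measure `μ_{n,β}` on the shift. -/
def gibbs (n : ℕ) (β : ℝ) : ProbabilityMeasure Shift := ⟨gibbsAux n β, inferInstance⟩

/-- The function `x ↦ log (cosh (β x)) - (β/2) x²`. -/
def phiI (β x : ℝ) : ℝ := Real.log (Real.cosh (β * x)) - β / 2 * x ^ 2

/-- The mixture `½ (μ + ν)`. -/
def halfSum (μ ν : ProbabilityMeasure Shift) : ProbabilityMeasure Shift :=
  ⟨(2⁻¹ : ℝ≥0∞) • ((μ : Measure Shift) + (ν : Measure Shift)), ⟨by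
    simp [ENNReal.inv_two_add_inv_two]⟩⟩

end

end CurieWeiss

namespace CurieWeiss

/-! ### Shannon entropy of finite partitions -/

section Shannon

/-! Equilibrium states. Compare an invariant `ν` with the Bernoulli measure of parameter `b` on
words of length `n`. The logarithm of a Bernoulli cylinder weight is a sum of affine functions of
the spins, so by stationarity Gibbs' inequality reads `blockEntropy ν n / n + b ∫ psi ≤ log (e^b +
e^{-b})`, with equality only if the two measures agree on words of length `n` (`blockEntropy_le`,
`measureReal_pre_eq_of_blockEntropy_eq`). The coordinate partition generates, so the
Kolmogorov–Sinai entropy is at most every `blockEntropy ν n / n` (`ksEntropy_le`). An equilibrium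
state therefore forces equality for all `n ≠ 0`, and is Bernoulli.

Weak limit. The energy is quadratic in the total spin, so completing a square writes `e^{-βH}` as a
Gaussian integral of product weights (`sqrt_mul_sum_exp_hamiltonian`). Hence on words of length `n`
the Gibbs measure is exactly a mixture of the measures `bernoulli (β * x)`, with density in `x`
proportional to `exp (phiI β x) ^ n` (`gibbs_real_pre_preimage`). As `phiI` is even, the mixture
folds onto the half-line, where Laplace's method concentrates it at the maximizer `ξ`; unfolding
gives equal masses at `ξ` and `-ξ` (`tendsto_gibbs_real_pre_preimage`).

Maximizer. The derivative of `phiI` is `β (tanh (β x) - x)`, and strict concavity of `tanh` allows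
only one maximum point. For `β ≤ 1` it is `0`, and the two halves coincide. -/

theorem negMulLog_add_mul_log_le {p q : ℝ} (hp : 0 ≤ p) (hq : 0 ≤ q) (h : q = 0 → p = 0) :
    Real.negMulLog p + p * Real.log q ≤ q - p := by
  rcases hp.eq_or_lt with rfl | hp
  · simpa using hq
  have hq : 0 < q := hq.lt_of_ne fun h0 => hp.ne' (h h0.symm)
  have h1 := mul_le_mul_of_nonneg_left (Real.log_le_sub_one_of_pos (div_pos hq hp)) hp.le
  rw [Real.log_div hq.ne' hp.ne', mul_sub, mul_sub, mul_div_cancel₀ _ hp.ne'] at h1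
  rw [Real.negMulLog]
  linarith

theorem eq_of_negMulLog_add_mul_log_eq {p q : ℝ} (hp : 0 ≤ p) (hq : 0 ≤ q) (h : q = 0 → p = 0)
    (heq : Real.negMulLog p + p * Real.log q = q - p) : p = q := by
  rcases hp.eq_or_lt with rfl | hp
  · simpa using heq
  have hq : 0 < q := hq.lt_of_ne fun h0 => hp.ne' (h h0.symm)
  by_contra hne
  have h1 := mul_lt_mul_of_pos_left (Real.log_lt_sub_one_of_pos (div_pos hq hp)
    (fun h1 => hne ((div_eq_one_iff_eq hp.ne').1 h1).symm)) hp
  rw [Real.log_div hq.ne' hp.ne', mul_sub, mul_sub, mul_div_cancel₀ _ hp.ne'] at h1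
  rw [Real.negMulLog] at heq
  linarith

/-- Gibbs' inequality. -/
theorem sum_negMulLog_le {ι : Type*} [Fintype ι] {p q : ι → ℝ} (hp : ∀ i, 0 ≤ p i)
    (hq : ∀ i, 0 ≤ q i) (h : ∀ i, q i = 0 → p i = 0) (hsum : ∑ i, q i = ∑ i, p i) :
    ∑ i, Real.negMulLog (p i) ≤ -∑ i, p i * Real.log (q i) := by
  have h1 := Finset.sum_le_sum fun i (_ : i ∈ Finset.univ) =>
    negMulLog_add_mul_log_le (hp i) (hq i) (h i)
  rw [Finset.sum_add_distrib, Finset.sum_sub_distrib, hsum] at h1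
  linarith

/-- The equality case of Gibbs' inequality. -/
theorem eq_of_sum_negMulLog_eq {ι : Type*} [Fintype ι] {p q : ι → ℝ} (hp : ∀ i, 0 ≤ p i)
    (hq : ∀ i, 0 ≤ q i) (h : ∀ i, q i = 0 → p i = 0) (hsum : ∑ i, q i = ∑ i, p i)
    (heq : ∑ i, Real.negMulLog (p i) = -∑ i, p i * Real.log (q i)) : p = q := by
  have h1 : ∑ i, (Real.negMulLog (p i) + p i * Real.log (q i)) = ∑ i, (q i - p i) := by
    rw [Finset.sum_add_distrib, Finset.sum_sub_distrib, hsum]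
    linarith
  have h2 := (Finset.sum_eq_sum_iff_of_le fun i (_ : i ∈ Finset.univ) =>
    negMulLog_add_mul_log_le (hp i) (hq i) (h i)).1 h1
  exact funext fun i => eq_of_negMulLog_add_mul_log_eq (hp i) (hq i) (h i) (h2 i (Finset.mem_univ i))

/-- `negMulLog` is subadditive on nonnegative reals. -/
theorem negMulLog_sum_le {ι : Type*} (s : Finset ι) {p : ι → ℝ} (hp : ∀ i, 0 ≤ p i) :
    Real.negMulLog (∑ i ∈ s, p i) ≤ ∑ i ∈ s, Real.negMulLog (p i) := by
  rw [Real.negMulLog, ← Finset.sum_neg_distrib, Finset.sum_mul]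
  refine Finset.sum_le_sum fun i hi => ?_
  rcases (hp i).eq_or_lt with h0 | h0
  · simp [← h0]
  have h1 := Real.log_le_log h0 (Finset.single_le_sum (fun j _ => hp j) hi)
  rw [Real.negMulLog, neg_mul, neg_mul, neg_le_neg_iff]
  exact mul_le_mul_of_nonneg_left h1 h0.le

/-! ### Entropy of joins and coarsenings, and of words along an orbit -/

variable {X : Type*} [MeasurableSpace X] {ι κ : Type*}

/-- All fibres of `f` are measurable. -/
def HasMeasurableFibers (f : X → ι) : Prop := ∀ a, MeasurableSet (f ⁻¹' {a})

theorem HasMeasurableFibers.preimage [Finite ι] {f : X → ι} (hf : HasMeasurableFibers f)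
    (s : Set ι) : MeasurableSet (f ⁻¹' s) := by
  rw [← Set.biUnion_preimage_singleton]
  exact s.toFinite.measurableSet_biUnion fun a _ => hf a

theorem HasMeasurableFibers.comp_left [Finite ι] {f : X → ι} (hf : HasMeasurableFibers f)
    (g : ι → κ) : HasMeasurableFibers (g ∘ f) := fun a => hf.preimage (g ⁻¹' {a})

theorem HasMeasurableFibers.prodMk {f : X → ι} {g : X → κ} (hf : HasMeasurableFibers f)
    (hg : HasMeasurableFibers g) : HasMeasurableFibers fun x => (f x, g x) := fun a => by
  have : (fun x => (f x, g x)) ⁻¹' {a} = f ⁻¹' {a.1} ∩ g ⁻¹' {a.2} := by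
    ext x; simp [Prod.ext_iff]
  rw [this]
  exact (hf _).inter (hg _)

theorem HasMeasurableFibers.comp_measurable {f : X → ι} (hf : HasMeasurableFibers f) {T : X → X}
    (hT : Measurable T) : HasMeasurableFibers (f ∘ T) := fun a => hT (hf a)

theorem HasMeasurableFibers.pi [Finite κ] {f : κ → X → ι} (hf : ∀ i, HasMeasurableFibers (f i)) :
    HasMeasurableFibers fun x i => f i x := fun a => by
  have : (fun x i => f i x) ⁻¹' {a} = ⋂ i, f i ⁻¹' {a i} := by
    ext x; simp [funext_iff]
  rw [this]
  exact MeasurableSet.iInter fun i => hf i _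

theorem hasMeasurableFibers_of_measurable [MeasurableSpace ι] [MeasurableSingletonClass ι]
    {f : X → ι} (hf : Measurable f) : HasMeasurableFibers f := fun a => hf (MeasurableSet.singleton a)

/-- The word of length `n` read off along the orbit of `x` by the function `f`. -/
def orbitWord (T : X → X) (f : X → ι) (n : ℕ) (x : X) : Fin n → ι := fun i => f (T^[i] x)

theorem HasMeasurableFibers.orbitWord {f : X → ι} (hf : HasMeasurableFibers f) {T : X → X}
    (hT : Measurable T) (n : ℕ) : HasMeasurableFibers (orbitWord T f n) :=
  HasMeasurableFibers.pi fun i : Fin n => hf.comp_measurable (hT.iterate i)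

theorem shannonEntropy_comp_measurePreserving [Fintype ι] (μ : Measure X) {T : X → X}
    (hT : MeasurePreserving T μ μ) {f : X → ι} (hf : HasMeasurableFibers f) :
    shannonEntropy μ (f ∘ T) = shannonEntropy μ f := by
  refine Finset.sum_congr rfl fun a _ => ?_
  rw [Set.preimage_comp, hT.measureReal_preimage (hf a).nullMeasurableSet]

variable [Fintype ι] [Fintype κ] (μ : Measure X) [IsProbabilityMeasure μ]

theorem sum_measureReal_fibers {f : X → ι} (hf : HasMeasurableFibers f) :
    ∑ a, μ.real (f ⁻¹' {a}) = 1 := by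
  rw [sum_measureReal_preimage_singleton _ fun a _ => hf a]
  simp

theorem shannonEntropy_nonneg (f : X → ι) : 0 ≤ shannonEntropy μ f :=
  Finset.sum_nonneg fun _ _ => Real.negMulLog_nonneg measureReal_nonneg measureReal_le_one

theorem shannonEntropy_comp_le {f : X → ι} (hf : HasMeasurableFibers f) (g : ι → κ) :
    shannonEntropy μ (g ∘ f) ≤ shannonEntropy μ f := by
  classical
  have h : ∀ b, μ.real ((g ∘ f) ⁻¹' {b}) = ∑ a with g a = b, μ.real (f ⁻¹' {a}) := fun b => by
    rw [sum_measureReal_preimage_singleton _ fun a _ => hf a]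
    congr 1
    ext x
    simp
  unfold shannonEntropy
  rw [← Finset.sum_fiberwise (s := Finset.univ) g]
  refine Finset.sum_le_sum fun b _ => ?_
  rw [h]
  exact negMulLog_sum_le _ fun _ => measureReal_nonneg

/-- Gibbs' inequality for the joint law against the product of its marginals: the logarithm of the
product splits, and summing out one variable returns the two entropies. -/
theorem shannonEntropy_prodMk_le {f : X → ι} {g : X → κ} (hf : HasMeasurableFibers f)
    (hg : HasMeasurableFibers g) :
    shannonEntropy μ (fun x => (f x, g x)) ≤ shannonEntropy μ f + shannonEntropy μ g := by
  set P : ι × κ → ℝ := fun c => μ.real ((fun x => (f x, g x)) ⁻¹' {c}) with hP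
  set p : ι → ℝ := fun a => μ.real (f ⁻¹' {a}) with hp
  set q : κ → ℝ := fun b => μ.real (g ⁻¹' {b}) with hq
  have hfg := hf.prodMk hg
  have hP0 : ∀ c, 0 ≤ P c := fun _ => measureReal_nonneg
  have hPp : ∀ c, P c ≤ p c.1 := fun c => measureReal_mono fun x hx => congrArg Prod.fst hx
  have hPq : ∀ c, P c ≤ q c.2 := fun c => measureReal_mono fun x hx => congrArg Prod.snd hx
  have h1 : ∀ a, ∑ b, P (a, b) = p a := fun a => by
    have : ∀ b, P (a, b) = (μ.restrict (f ⁻¹' {a})).real (g ⁻¹' {b}) := fun b => by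
      rw [measureReal_restrict_apply (hg b)]
      refine congrArg μ.real ?_
      ext x
      simp [and_comm]
    simp_rw [this]
    rw [sum_measureReal_preimage_singleton _ fun b _ => hg b]
    simp [hp]
  have h2 : ∀ b, ∑ a, P (a, b) = q b := fun b => by
    have : ∀ a, P (a, b) = (μ.restrict (g ⁻¹' {b})).real (f ⁻¹' {a}) := fun a => by
      rw [measureReal_restrict_apply (hf a)]
      refine congrArg μ.real ?_
      ext x
      simp
    simp_rw [this]
    rw [sum_measureReal_preimage_singleton _ fun b _ => hf b]
    simp [hq]
  have hsum : ∑ c : ι × κ, p c.1 * q c.2 = ∑ c, P c := by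
    rw [Fintype.sum_prod_type, sum_measureReal_fibers μ hfg]
    simp only [← Finset.mul_sum, ← Finset.sum_mul]
    rw [sum_measureReal_fibers μ hf, sum_measureReal_fibers μ hg, one_mul]
  have key := sum_negMulLog_le (p := P) (q := fun c => p c.1 * q c.2) hP0
    (fun c => mul_nonneg measureReal_nonneg measureReal_nonneg) (fun c hc => by
      rcases mul_eq_zero.1 hc with h | h
      · exact le_antisymm (h ▸ hPp c) (hP0 c)
      · exact le_antisymm (h ▸ hPq c) (hP0 c)) hsum
  refine key.trans_eq ?_
  have hlog : ∀ c : ι × κ, P c * Real.log (p c.1 * q c.2) =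
      P c * Real.log (p c.1) + P c * Real.log (q c.2) := fun c => by
    rcases (hP0 c).eq_or_lt with h0 | h0
    · simp [← h0]
    · rw [Real.log_mul (h0.trans_le (hPp c)).ne' (h0.trans_le (hPq c)).ne', mul_add]
  simp_rw [hlog]
  rw [Finset.sum_add_distrib, Fintype.sum_prod_type, Fintype.sum_prod_type_right]
  simp only [← Finset.sum_mul, h1, h2]
  rw [neg_add, ← Finset.sum_neg_distrib, ← Finset.sum_neg_distrib]
  simp only [shannonEntropy, Real.negMulLog, neg_mul, hp, hq]

/-- A word of length `m + n` is the word of length `m` followed by the word of length `n` seen from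
`T^[m] x`, and invariance removes the time shift. -/
theorem shannonEntropy_orbitWord_add_le {T : X → X} (hT : MeasurePreserving T μ μ)
    {f : X → ι} (hf : HasMeasurableFibers f) (m n : ℕ) :
    shannonEntropy μ (orbitWord T f (m + n)) ≤
      shannonEntropy μ (orbitWord T f m) + shannonEntropy μ (orbitWord T f n) := by
  have hm := hf.orbitWord hT.measurable m
  have hn := hf.orbitWord hT.measurable n
  have hTm := hT.iterate m
  have hn' := hn.comp_measurable hTm.measurable
  have h : orbitWord T f (m + n) = (fun c : (Fin m → ι) × (Fin n → ι) => Fin.append c.1 c.2) ∘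
      fun x => (orbitWord T f m x, (orbitWord T f n ∘ T^[m]) x) := by
    ext x i
    refine Fin.addCases (fun j => ?_) (fun j => ?_) i
    · simp [orbitWord]
    · simp [orbitWord, ← Function.iterate_add_apply, add_comm]
  rw [h]
  refine (shannonEntropy_comp_le μ (hm.prodMk hn') _).trans
    ((shannonEntropy_prodMk_le μ hm hn').trans_eq ?_)
  rw [shannonEntropy_comp_measurePreserving μ hTm hn]

theorem shannonEntropy_orbitWord_le {T : X → X} (hT : MeasurePreserving T μ μ)
    {f : X → ι} (hf : HasMeasurableFibers f) (n : ℕ) :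
    shannonEntropy μ (orbitWord T f n) ≤ n * shannonEntropy μ f := by
  induction n with
  | zero =>
    have : orbitWord T f 0 ⁻¹' {Fin.elim0} = Set.univ := by
      ext x; simp [Subsingleton.elim (orbitWord T f 0 x) Fin.elim0]
    simp [shannonEntropy, Subsingleton.elim default (Fin.elim0 : Fin 0 → ι),
      this]
  | succ n ih =>
    have h0 : orbitWord T f 1 = (fun a (_ : Fin 1) => a) ∘ f := by
      ext x i
      simp [orbitWord, Subsingleton.elim i 0]
    have h1 : shannonEntropy μ (orbitWord T f 1) ≤ shannonEntropy μ f :=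
      h0 ▸ shannonEntropy_comp_le μ hf _
    have h2 := shannonEntropy_orbitWord_add_le μ hT hf n 1
    push_cast
    linarith

/-- A finite-valued function that takes one given value with high probability has small
entropy. -/
theorem exists_pos_forall_shannonEntropy_lt {ι : Type*} [Fintype ι] {ε : ℝ} (hε : 0 < ε) :
    ∃ δ > 0, ∀ (f : X → ι) (a₀ : ι), HasMeasurableFibers f →
      μ.real {x | f x ≠ a₀} < δ → shannonEntropy μ f < ε := by
  have hc0 : Tendsto Real.negMulLog (𝓝 0) (𝓝 0) := by
    simpa using Real.continuous_negMulLog.tendsto 0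
  have hc1 : Tendsto Real.negMulLog (𝓝 1) (𝓝 0) := by
    simpa using Real.continuous_negMulLog.tendsto 1
  -- `negMulLog` is continuous and vanishes at `0` and `1`, so each term can be kept below `η`; the
  -- `+ 1` makes the total strictly less than `ε`, and avoids dividing by zero.
  set η := ε / (Fintype.card ι + 1) with hη
  have hηpos : 0 < η := by positivity
  obtain ⟨δ₀, hδ₀, h0⟩ := Metric.tendsto_nhds_nhds.1 hc0 η hηpos
  obtain ⟨δ₁, hδ₁, h1⟩ := Metric.tendsto_nhds_nhds.1 hc1 η hηpos
  refine ⟨min δ₀ δ₁, lt_min hδ₀ hδ₁, fun f a₀ hf h => ?_⟩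
  have hlt : ∀ a, Real.negMulLog (μ.real (f ⁻¹' {a})) < η := fun a => by
    by_cases ha : a = a₀
    · subst ha
      have hcompl : {x | f x ≠ a} = (f ⁻¹' {a})ᶜ := by ext x; simp
      rw [hcompl, probReal_compl_eq_one_sub (hf a)] at h
      have := h1 (x := μ.real (f ⁻¹' {a})) (by
        rw [Real.dist_eq, abs_sub_comm, abs_of_nonneg (sub_nonneg.2 measureReal_le_one)]
        exact h.trans_le (min_le_right _ _))
      rw [Real.dist_eq, sub_zero] at this
      exact (le_abs_self _).trans_lt this
    · have hle : μ.real (f ⁻¹' {a}) ≤ μ.real {x | f x ≠ a₀} :=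
        measureReal_mono fun x (hx : f x = a) => by simpa [hx] using ha
      have := h0 (x := μ.real (f ⁻¹' {a})) (by
        rw [Real.dist_eq, sub_zero, abs_of_nonneg measureReal_nonneg]
        exact (hle.trans_lt h).trans_le (min_le_left _ _))
      rw [Real.dist_eq, sub_zero] at this
      exact (le_abs_self _).trans_lt this
  calc shannonEntropy μ f ≤ ∑ _a : ι, η := Finset.sum_le_sum fun a _ => (hlt a).le
    _ = Fintype.card ι * η := by simp
    _ < ε := by
      rw [hη, mul_div_assoc', div_lt_iff₀ (by positivity)]
      nlinarith

end Shannon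

/-! ### The coordinate partition generates: an upper bound for the Kolmogorov–Sinai entropy -/

section Generator

theorem measurable_shift : Measurable shift :=
  measurable_pi_lambda _ fun i => measurable_pi_apply (i + 1)

theorem shift_iterate_apply (n : ℕ) (x : Shift) (i : ℕ) : shift^[n] x i = x (i + n) := by
  induction n generalizing x with
  | zero => rfl
  | succ n ih => rw [Function.iterate_succ_apply, ih, shift, add_assoc, add_comm n 1]

theorem pre_eq_orbitWord (n : ℕ) : pre n = orbitWord shift (fun x => x 0) n := by
  ext x i
  simp [pre, orbitWord, shift_iterate_apply]

theorem hasMeasurableFibers_pre (n : ℕ) : HasMeasurableFibers (pre n) :=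
  hasMeasurableFibers_of_measurable (measurable_pre n)

theorem hasMeasurableFibers_apply (i : ℕ) : HasMeasurableFibers fun x : Shift => x i :=
  hasMeasurableFibers_of_measurable (measurable_pi_apply i)

/-- A measurable cylinder only depends on a long enough prefix. -/
theorem exists_forall_ge_eq_pre_preimage {t : Set Shift}
    (ht : t ∈ measurableCylinders fun _ : ℕ => ℤˣ) :
    ∃ M, ∀ N ≥ M, ∃ B : Set (Fin N → ℤˣ), t = pre N ⁻¹' B := by
  obtain ⟨s, S, -, rfl⟩ := (mem_measurableCylinders _).1 ht
  refine ⟨s.sup id + 1, fun N hN => ?_⟩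
  have hs : ∀ i : s, (i : ℕ) < N := fun i =>
    (Nat.lt_succ_of_le (Finset.le_sup (f := id) i.2)).trans_le hN
  exact ⟨{w | (fun i : s => w ⟨i, hs i⟩) ∈ S}, rfl⟩

/-- Measurable sets are approximated in measure by unions of cylinders. -/
theorem exists_forall_ge_measureReal_symmDiff_lt (ν : Measure Shift) [IsProbabilityMeasure ν]
    {A : Set Shift} (hA : MeasurableSet A) {ε : ℝ} (hε : 0 < ε) :
    ∃ M, ∀ N ≥ M, ∃ B : Set (Fin N → ℤˣ), ν.real (symmDiff (pre N ⁻¹' B) A) < ε := by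
  obtain ⟨t, ht, hlt⟩ := exists_measure_symmDiff_lt_of_generateFrom_isSetRing (μ := ν)
    (C := measurableCylinders fun _ : ℕ => ℤˣ) isSetRing_measurableCylinders
    ⟨{Set.univ}, Set.countable_singleton _,
      by simpa using univ_mem_measurableCylinders (fun _ : ℕ => ℤˣ), by simp⟩
    generateFrom_measurableCylinders.symm hA (ENNReal.ofReal_pos.2 hε)
  obtain ⟨M, hM⟩ := exists_forall_ge_eq_pre_preimage ht
  refine ⟨M, fun N hN => ?_⟩
  obtain ⟨B, rfl⟩ := hM N hN
  exact ⟨B, (ENNReal.lt_ofReal_iff_toReal_lt (measure_ne_top _ _)).1 hlt⟩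

/-- Finite partitions are approximated in measure by partitions into unions of cylinders. -/
theorem exists_measureReal_ne_lt (ν : Measure Shift) [IsProbabilityMeasure ν] {k : ℕ}
    {f : Shift → Fin k} (hf : Measurable f) {δ : ℝ} (hδ : 0 < δ) :
    ∃ (N : ℕ) (g : (Fin N → ℤˣ) → Fin k), ν.real {x | f x ≠ g (pre N x)} < δ := by
  classical
  choose M hM using fun a : Fin k => exists_forall_ge_measureReal_symmDiff_lt ν
    (hf (MeasurableSet.singleton a)) (show 0 < δ / (k + 1) by positivity)
  set N := Finset.univ.sup M
  choose B hB using fun a => hM a N (Finset.le_sup (Finset.mem_univ a))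
  -- The sets `B a` need be neither disjoint nor covering. The choice and the default `f 1` (`1` the
  -- constant word) are arbitrary: they matter only on the exceptional set bounded below.
  refine ⟨N, fun w => if h : ∃ a, w ∈ B a then h.choose else f 1, ?_⟩
  have hsub : {x | f x ≠ if h : ∃ a, pre N x ∈ B a then h.choose else f 1} ⊆
      ⋃ a ∈ Finset.univ, symmDiff (pre N ⁻¹' B a) (f ⁻¹' {a}) := by
    intro x hx
    by_contra hnot
    simp only [Finset.mem_univ, Set.iUnion_true, Set.mem_iUnion, not_exists] at hnot
    have hiff : ∀ a, pre N x ∈ B a ↔ f x = a := fun a => by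
      have := hnot a
      simp only [Set.mem_symmDiff, Set.mem_preimage, Set.mem_singleton_iff] at this
      tauto
    have hex : ∃ a, pre N x ∈ B a := ⟨f x, (hiff _).2 rfl⟩
    refine hx ?_
    rw [dif_pos hex]
    exact (hiff _).1 hex.choose_spec
  calc ν.real {x | f x ≠ if h : ∃ a, pre N x ∈ B a then h.choose else f 1}
      ≤ ν.real (⋃ a ∈ Finset.univ, symmDiff (pre N ⁻¹' B a) (f ⁻¹' {a})) :=
        measureReal_mono hsub (measure_ne_top _ _)
    _ ≤ ∑ a, ν.real (symmDiff (pre N ⁻¹' B a) (f ⁻¹' {a})) :=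
        measureReal_biUnion_finset_le _ _
    _ ≤ ∑ _a : Fin k, δ / (k + 1) := Finset.sum_le_sum fun a _ => (hB a).le
    _ = k * (δ / (k + 1)) := by simp
    _ < δ := by
      rw [mul_div_assoc', div_lt_iff₀ (by positivity)]
      nlinarith

/-- The entropy of the partition into cylinders of length `n`. -/
noncomputable def blockEntropy (ν : Measure Shift) (n : ℕ) : ℝ := shannonEntropy ν (pre n)

variable {ν : Measure Shift} [IsProbabilityMeasure ν]

theorem subadditive_blockEntropy (hν : MeasurePreserving shift ν ν) :
    Subadditive (blockEntropy ν) := fun m n => by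
  simp only [blockEntropy, pre_eq_orbitWord]
  exact shannonEntropy_orbitWord_add_le ν hν (hasMeasurableFibers_apply 0) m n

theorem bddBelow_blockEntropy_div (ν : Measure Shift) [IsProbabilityMeasure ν] :
    BddBelow (Set.range fun n : ℕ => blockEntropy ν n / n) :=
  ⟨0, by
    rintro _ ⟨n, rfl⟩
    exact div_nonneg (shannonEntropy_nonneg ν _) (Nat.cast_nonneg n)⟩

/-- Entropy of an itinerary, in terms of an approximating partition and of the error. -/
theorem shannonEntropy_itinerary_le (hν : MeasurePreserving shift ν ν) {k : ℕ}
    {f : Shift → Fin k} (hf : Measurable f) {N : ℕ} (g : (Fin N → ℤˣ) → Fin k) (n : ℕ) :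
    shannonEntropy ν (itinerary shift f n) ≤ blockEntropy ν n + blockEntropy ν N +
      n * shannonEntropy ν fun x => if f x = g (pre N x) then none else some (f x) := by
  set e : Shift → Option (Fin k) := fun x => if f x = g (pre N x) then none else some (f x) with he
  have hfm := hasMeasurableFibers_of_measurable hf
  have hpN := hasMeasurableFibers_pre N
  have hem : HasMeasurableFibers e :=
    (hfm.prodMk hpN).comp_left fun c => if c.1 = g c.2 then none else some c.1
  have hen := hem.orbitWord hν.measurable n
  have hpn := hasMeasurableFibers_pre (n + N)
  -- The function `e` reports the true symbol exactly when the guess from the next `N` letters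
  -- fails. A prefix of length `n + N` supplies all `n` guesses, so together with the reports it
  -- determines the itinerary.
  have hfun : itinerary shift f n =
      (fun (c : (Fin (n + N) → ℤˣ) × (Fin n → Option (Fin k))) (i : Fin n) =>
        (c.2 i).getD (g fun j => c.1 ⟨i + j, add_lt_add i.2 j.2⟩)) ∘
      fun x => (pre (n + N) x, orbitWord shift e n x) := by
    ext x i
    have hpre : (fun j : Fin N => pre (n + N) x ⟨i + j, add_lt_add i.2 j.2⟩) =
        pre N (shift^[i] x) := by
      ext j
      simp [pre, shift_iterate_apply, add_comm]
    simp only [itinerary, Function.comp, hpre, orbitWord, he]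
    split_ifs with h
    · simp [h]
    · simp
  rw [hfun]
  refine (shannonEntropy_comp_le ν (hpn.prodMk hen) _).trans
    ((shannonEntropy_prodMk_le ν hpn hen).trans ?_)
  exact add_le_add (subadditive_blockEntropy hν n N)
    (shannonEntropy_orbitWord_le ν hν hem n)

/-- The bound for a generating partition: approximate `f` by a function of `N` letters so well that
the error has entropy below `z - hsub.lim`. After division by `n` the fixed cost `blockEntropy ν N`
disappears and the limsup is at most `z`, for any `z` above the limit. By Fekete's lemma that limit
is at most `blockEntropy ν m / m`. -/
theorem partitionEntropy_le (hν : MeasurePreserving shift ν ν) {k : ℕ}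
    {f : Shift → Fin k} (hf : Measurable f) {m : ℕ} (hm : m ≠ 0) :
    partitionEntropy ν shift f ≤ ((blockEntropy ν m / m : ℝ) : EReal) := by
  have hsub := subadditive_blockEntropy hν
  have hbdd := bddBelow_blockEntropy_div ν
  refine le_trans ?_ (EReal.coe_le_coe_iff.2 (hsub.lim_le_div hbdd hm))
  refine EReal.le_of_forall_lt_iff_le.1 fun z hz => ?_
  rw [EReal.coe_lt_coe_iff] at hz
  obtain ⟨δ, hδ, hδε⟩ := exists_pos_forall_shannonEntropy_lt ν (ι := Option (Fin k))
    (sub_pos.2 hz)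
  obtain ⟨N, g, hg⟩ := exists_measureReal_ne_lt ν hf hδ
  set e : Shift → Option (Fin k) := fun x => if f x = g (pre N x) then none else some (f x) with he
  have hem : HasMeasurableFibers e :=
    ((hasMeasurableFibers_of_measurable hf).prodMk (hasMeasurableFibers_pre N)).comp_left
      fun c => if c.1 = g c.2 then none else some c.1
  have hset : {x | e x ≠ none} = {x | f x ≠ g (pre N x)} := by
    ext x; simp [he]
  have hHe : shannonEntropy ν e < z - hsub.lim := hδε e none hem (hset ▸ hg)
  have hlim : Tendsto (fun n : ℕ => blockEntropy ν n / n + blockEntropy ν N / n +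
      shannonEntropy ν e) atTop (𝓝 (hsub.lim + 0 + shannonEntropy ν e)) :=
    ((hsub.tendsto_lim hbdd).add (tendsto_const_div_atTop_nhds_zero_nat _)).add tendsto_const_nhds
  have hlim' := (continuous_coe_real_ereal.tendsto _).comp hlim
  refine le_trans ?_ (EReal.coe_le_coe_iff.2
    (show hsub.lim + 0 + shannonEntropy ν e ≤ z by linarith))
  rw [← hlim'.limsup_eq]
  refine limsup_le_limsup ?_
  filter_upwards [eventually_gt_atTop 0] with n hn
  refine EReal.coe_le_coe_iff.2 ?_
  have hn' : (0 : ℝ) < n := Nat.cast_pos.2 hn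
  rw [div_le_iff₀ hn', add_mul, add_mul, div_mul_cancel₀ _ hn'.ne', div_mul_cancel₀ _ hn'.ne',
    mul_comm (shannonEntropy ν e)]
  exact shannonEntropy_itinerary_le hν hf g n

theorem ksEntropy_le (hν : MeasurePreserving shift ν ν) {m : ℕ} (hm : m ≠ 0) :
    ksEntropy ν shift ≤ ((blockEntropy ν m / m : ℝ) : EReal) :=
  iSup_le fun _ => iSup_le fun _ => iSup_le fun hf => partitionEntropy_le hν hf hm

/-- A lower bound for the Kolmogorov–Sinai entropy through the coordinate partition. -/
theorem le_ksEntropy {c : ℝ} (h : ∀ n, n * c ≤ blockEntropy ν n) :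
    (c : EReal) ≤ ksEntropy ν shift := by
  set f : Shift → Fin 2 := fun x => if x 0 = 1 then 0 else 1 with hf
  have hfm : Measurable f :=
    (measurable_of_finite fun u : ℤˣ => (if u = 1 then 0 else 1 : Fin 2)).comp
      (measurable_pi_apply 0)
  refine le_trans ?_ (le_iSup_of_le 2 (le_iSup_of_le f (le_iSup_of_le hfm le_rfl)))
  rw [← limsup_const (f := (atTop : Filter ℕ)) (c : EReal)]
  refine limsup_le_limsup ?_
  filter_upwards [eventually_gt_atTop 0] with n hn
  refine EReal.coe_le_coe_iff.2 ?_
  have hn' : (0 : ℝ) < n := Nat.cast_pos.2 hn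
  rw [le_div_iff₀ hn', mul_comm]
  refine (h n).trans ?_
  -- The `0`/`1` coding of the first letter loses nothing, so the prefix is a function of the
  -- itinerary.
  have hpre : pre n = (fun (w : Fin n → Fin 2) i => if w i = 0 then (1 : ℤˣ) else -1) ∘
      itinerary shift f n := by
    ext x i
    rcases Int.units_eq_one_or (x i) with h | h <;>
      simp [pre, itinerary, hf, shift_iterate_apply, h]
  rw [blockEntropy, hpre]
  exact shannonEntropy_comp_le ν
    ((hasMeasurableFibers_of_measurable hfm).orbitWord measurable_shift n) _

end Generator

/-! ### Bernoulli measures -/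

section Bernoulli

/-- The mass that `spinLaw b` gives to `u`. -/
noncomputable def spinWeight (b : ℝ) (u : ℤˣ) : ℝ :=
  Real.exp (b * ((u : ℤ) : ℝ)) / (Real.exp b + Real.exp (-b))

theorem spinWeight_pos (b : ℝ) (u : ℤˣ) : 0 < spinWeight b u := by
  unfold spinWeight; positivity

theorem spinLaw_singleton (b : ℝ) (u : ℤˣ) :
    spinLaw b {u} = ENNReal.ofReal (spinWeight b u) := by
  rcases Int.units_eq_one_or u with rfl | rfl <;> simp [spinLaw, spinWeight, Set.indicator]

theorem spinLaw_zero : spinLaw 0 = rho := by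
  have h : ENNReal.ofReal (1 / (1 + 1)) = 2⁻¹ := by
    rw [one_add_one_eq_two, one_div, ENNReal.ofReal_inv_of_pos (by norm_num)]
    simp
  simp only [spinLaw, rho, neg_zero, Real.exp_zero, h]

theorem bernoulli_zero : bernoulli 0 = unif := by
  refine Subtype.ext ?_
  simp only [bernoulli, unif, spinLaw_zero]

theorem bernoulli_real_pre (b : ℝ) (n : ℕ) (w : Fin n → ℤˣ) :
    (bernoulli b : Measure Shift).real (pre n ⁻¹' {w}) = ∏ i, spinWeight b (w i) := by
  have h : pre n ⁻¹' {w} =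
      Set.pi (Finset.range n : Set ℕ) (fun i => if hi : i < n then {w ⟨i, hi⟩} else Set.univ) := by
    ext y
    simp only [Set.mem_preimage, Set.mem_singleton_iff, funext_iff, pre, Set.mem_pi,
      Finset.coe_range, Set.mem_Iio]
    constructor
    · intro hy i hi
      simpa [hi] using hy ⟨i, hi⟩
    · intro hy i
      simpa [i.2] using hy i i.2
  change (Measure.infinitePi (fun _ => spinLaw b)).real _ = _
  rw [measureReal_def, h, Measure.infinitePi_pi _ fun i _ => (Set.toFinite _).measurableSet,
    Finset.prod_range, ENNReal.toReal_prod]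
  refine Finset.prod_congr rfl fun i _ => ?_
  rw [dif_pos i.2, spinLaw_singleton, ENNReal.toReal_ofReal (spinWeight_pos _ _).le]

theorem isShiftInvariant_bernoulli (b : ℝ) : IsShiftInvariant (bernoulli b) := by
  refine ⟨measurable_shift, ?_⟩
  change Measure.map shift (Measure.infinitePi fun _ => spinLaw b) =
    Measure.infinitePi fun _ => spinLaw b
  refine Measure.eq_infinitePi _ fun s t ht => ?_
  have h : shift ⁻¹' Set.pi (s : Set ℕ) t =
      Set.pi (s.image Nat.succ : Set ℕ) fun i => t (i - 1) := by
    ext x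
    simp [Set.mem_pi, shift]
  rw [Measure.map_apply measurable_shift (MeasurableSet.pi s.countable_toSet fun i _ => ht i), h,
    Measure.infinitePi_pi _ fun i _ => ht _, Finset.prod_image Nat.succ_injective.injOn]
  simp

/-- A probability measure on the shift is determined by its values on cylinders. -/
theorem ext_of_pre {μ ν : Measure Shift} [IsProbabilityMeasure μ] [IsProbabilityMeasure ν]
    (h : ∀ n, n ≠ 0 → ∀ w : Fin n → ℤˣ, μ.real (pre n ⁻¹' {w}) = ν.real (pre n ⁻¹' {w})) :
    μ = ν := by
  refine ext_of_generate_finite _ generateFrom_measurableCylinders.symm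
    isPiSystem_measurableCylinders (fun t ht => ?_) (by simp)
  obtain ⟨M, hM⟩ := exists_forall_ge_eq_pre_preimage ht
  -- Length `M + 1` rather than `M`, since the hypothesis only covers nonempty words.
  obtain ⟨B, rfl⟩ := hM (M + 1) (Nat.le_succ M)
  have hB : ∀ (ρ : Measure Shift) [IsProbabilityMeasure ρ], ρ.real (pre (M + 1) ⁻¹' B) =
      ∑ w ∈ B.toFinite.toFinset, ρ.real (pre (M + 1) ⁻¹' {w}) := fun ρ _ => by
    rw [sum_measureReal_preimage_singleton _ fun a _ => hasMeasurableFibers_pre _ a]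
    simp
  rw [← measureReal_eq_measureReal_iff, hB μ, hB ν]
  exact Finset.sum_congr rfl fun w _ => h _ (Nat.succ_ne_zero M) w

theorem psi_apply (x : Shift) : psi x = ((x 0 : ℤ) : ℝ) := by
  rcases Int.units_eq_one_or (x 0) with h | h <;>
    simp [psi, cyl, Set.indicator, h]

theorem integral_apply_eq {ν : Measure Shift} (hν : MeasurePreserving shift ν ν) (i : ℕ) :
    ∫ x, ((x i : ℤ) : ℝ) ∂ν = ∫ x, psi x ∂ν := by
  have h := hν.iterate i
  conv_rhs => rw [← h.map_eq]
  rw [integral_map h.measurable.aemeasurable psi.continuous.aestronglyMeasurable]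
  simp [psi_apply, shift_iterate_apply]

theorem integral_smul_psi (ν : Measure Shift) (b : ℝ) : ∫ x, (b • psi) x ∂ν = b * ∫ x, psi x ∂ν := by
  simp [integral_const_mul]

variable (ν : Measure Shift) [IsProbabilityMeasure ν]

theorem integral_comp_pre (n : ℕ) (F : (Fin n → ℤˣ) → ℝ) :
    ∫ x, F (pre n x) ∂ν = ∑ w, ν.real (pre n ⁻¹' {w}) * F w := by
  have := Measure.isProbabilityMeasure_map (μ := ν) (measurable_pre n).aemeasurable
  rw [← integral_map (measurable_pre n).aemeasurable
    (measurable_of_finite F).aestronglyMeasurable, integral_fintype (Integrable.of_finite)]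
  refine Finset.sum_congr rfl fun w _ => ?_
  rw [map_measureReal_apply (measurable_pre n) (MeasurableSet.singleton w), smul_eq_mul]

theorem integrable_apply (i : ℕ) : Integrable (fun x : Shift => ((x i : ℤ) : ℝ)) ν := by
  refine Integrable.of_bound (C := 1) (Measurable.aestronglyMeasurable
    ((measurable_of_finite fun u : ℤˣ => ((u : ℤ) : ℝ)).comp (measurable_pi_apply i)))
    (Eventually.of_forall fun x => ?_)
  rcases Int.units_eq_one_or (x i) with h | h <;> simp [h]

variable {ν} in
/-- The relative entropy term against a Bernoulli measure. -/
theorem sum_mul_log_prod_spinWeight (hν : MeasurePreserving shift ν ν) (b : ℝ) (n : ℕ) :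
    ∑ w : Fin n → ℤˣ, ν.real (pre n ⁻¹' {w}) * Real.log (∏ i, spinWeight b (w i)) =
      n * (b * ∫ x, psi x ∂ν - Real.log (Real.exp b + Real.exp (-b))) := by
  have h : ∀ w : Fin n → ℤˣ, Real.log (∏ i, spinWeight b (w i)) =
      ∑ i, (b * ((w i : ℤ) : ℝ) - Real.log (Real.exp b + Real.exp (-b))) := fun w => by
    rw [Real.log_prod fun i _ => (spinWeight_pos _ _).ne']
    refine Finset.sum_congr rfl fun i _ => ?_
    rw [spinWeight, Real.log_div (Real.exp_pos _).ne' (by positivity), Real.log_exp]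
  rw [← integral_comp_pre ν n fun w => Real.log (∏ i, spinWeight b (w i))]
  simp_rw [h]
  rw [integral_finsetSum]
  · simp only [pre]
    have : ∀ i : Fin n, ∫ x : Shift, (b * ((x i : ℤ) : ℝ) -
        Real.log (Real.exp b + Real.exp (-b))) ∂ν =
        b * ∫ x, psi x ∂ν - Real.log (Real.exp b + Real.exp (-b)) := fun i => by
      rw [integral_sub ((integrable_apply ν i).const_mul b) (integrable_const _),
        integral_const_mul, integral_apply_eq hν]
      simp
    simp only [this, Finset.sum_const, Finset.card_univ, Fintype.card_fin, nsmul_eq_mul]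
  · intro i _
    exact ((integrable_apply ν i).const_mul b).sub (integrable_const _)

theorem sum_prod_spinWeight (b : ℝ) (n : ℕ) :
    ∑ w : Fin n → ℤˣ, ∏ i, spinWeight b (w i) = 1 := by
  simp_rw [← bernoulli_real_pre]
  exact sum_measureReal_fibers _ (hasMeasurableFibers_pre n)

variable {ν} in
theorem blockEntropy_le (hν : MeasurePreserving shift ν ν) (b : ℝ) (n : ℕ) :
    blockEntropy ν n ≤ n * (Real.log (Real.exp b + Real.exp (-b)) - b * ∫ x, psi x ∂ν) := by
  refine (sum_negMulLog_le (q := fun w : Fin n → ℤˣ => ∏ i, spinWeight b (w i))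
    (fun _ => measureReal_nonneg) (fun w => Finset.prod_nonneg fun i _ => (spinWeight_pos _ _).le)
    (fun w hw => absurd hw (Finset.prod_pos fun i _ => spinWeight_pos b _).ne') ?_).trans_eq ?_
  · rw [sum_prod_spinWeight, sum_measureReal_fibers ν (hasMeasurableFibers_pre n)]
  · rw [sum_mul_log_prod_spinWeight hν]
    ring

variable {ν} in
theorem measureReal_pre_eq_of_blockEntropy_eq (hν : MeasurePreserving shift ν ν) (b : ℝ) (n : ℕ)
    (h : blockEntropy ν n = n * (Real.log (Real.exp b + Real.exp (-b)) - b * ∫ x, psi x ∂ν))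
    (w : Fin n → ℤˣ) : ν.real (pre n ⁻¹' {w}) = ∏ i, spinWeight b (w i) := by
  refine congrFun (eq_of_sum_negMulLog_eq (p := fun w => ν.real (pre n ⁻¹' {w}))
    (q := fun w : Fin n → ℤˣ => ∏ i, spinWeight b (w i))
    (fun _ => measureReal_nonneg) (fun w => Finset.prod_nonneg fun i _ => (spinWeight_pos _ _).le)
    (fun w hw => absurd hw (Finset.prod_pos fun i _ => spinWeight_pos b _).ne') ?_ ?_) w
  · rw [sum_prod_spinWeight, sum_measureReal_fibers ν (hasMeasurableFibers_pre n)]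
  · rw [sum_mul_log_prod_spinWeight hν]
    refine h.trans ?_
    ring

theorem blockEntropy_bernoulli (b : ℝ) (n : ℕ) :
    blockEntropy (bernoulli b : Measure Shift) n =
      n * (Real.log (Real.exp b + Real.exp (-b)) -
        b * ∫ x, psi x ∂(bernoulli b : Measure Shift)) := by
  have h := sum_mul_log_prod_spinWeight (isShiftInvariant_bernoulli b) b n
  simp only [blockEntropy, shannonEntropy, Real.negMulLog, neg_mul, Finset.sum_neg_distrib]
  simp only [bernoulli_real_pre] at h ⊢
  rw [h]
  ring

/-! ### Pressure and uniqueness of the equilibrium state -/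

theorem freeEnergy_le (b : ℝ) {μ : ProbabilityMeasure Shift} (hμ : IsShiftInvariant μ) :
    freeEnergy (b • psi) μ ≤ (Real.log (Real.exp b + Real.exp (-b)) : ℝ) := by
  have h1 := ksEntropy_le hμ one_ne_zero
  have h2 := blockEntropy_le hμ b 1
  rw [freeEnergy, integral_smul_psi]
  refine (add_le_add_left h1 _).trans ?_
  rw [← EReal.coe_add, EReal.coe_le_coe_iff]
  simp only [Nat.cast_one, div_one, one_mul] at h2 ⊢
  linarith

theorem freeEnergy_bernoulli (b : ℝ) :
    freeEnergy (b • psi) (bernoulli b) = (Real.log (Real.exp b + Real.exp (-b)) : ℝ) := by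
  refine le_antisymm (freeEnergy_le b (isShiftInvariant_bernoulli b)) ?_
  have h := le_ksEntropy (ν := (bernoulli b : Measure Shift))
    fun n => (blockEntropy_bernoulli b n).ge
  rw [freeEnergy, integral_smul_psi]
  refine le_trans ?_ (add_le_add_left h _)
  rw [← EReal.coe_add, sub_add_cancel]

theorem pressure_smul_psi (b : ℝ) :
    pressure (b • psi) = (Real.log (Real.exp b + Real.exp (-b)) : ℝ) :=
  le_antisymm (iSup₂_le fun _ hμ => freeEnergy_le b hμ)
    ((freeEnergy_bernoulli b).symm.le.trans
      (le_iSup₂_of_le (bernoulli b) (isShiftInvariant_bernoulli b) le_rfl))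

theorem isDynamicalGibbsMeasure_bernoulli (b : ℝ) :
    IsDynamicalGibbsMeasure (b • psi) (bernoulli b) := by
  refine ⟨⟨isShiftInvariant_bernoulli b, ?_⟩, fun ν ⟨hν, heq⟩ => ?_⟩
  · rw [freeEnergy_bernoulli, pressure_smul_psi]
  refine ProbabilityMeasure.toMeasure_injective (ext_of_pre fun n hn w => ?_)
  rw [bernoulli_real_pre]
  refine measureReal_pre_eq_of_blockEntropy_eq hν b n
    (le_antisymm (blockEntropy_le hν b n) ?_) w
  rw [pressure_smul_psi, freeEnergy, integral_smul_psi] at heq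
  -- Attaining the pressure bounds `blockEntropy ν n` from below by the value that Gibbs' inequality
  -- allows at most, so its equality case applies.
  have h := add_le_add_left (ksEntropy_le hν hn)
    ((b * ∫ x, psi x ∂(ν : Measure Shift) : ℝ) : EReal)
  rw [heq, ← EReal.coe_add, EReal.coe_le_coe_iff, ← sub_le_iff_le_add,
    le_div_iff₀ (Nat.cast_pos.2 (Nat.pos_of_ne_zero hn))] at h
  rw [mul_comm]
  exact h

end Bernoulli

/-! ### The maximum of `phiI` -/

section RateFunction

theorem hasDerivAt_tanh (x : ℝ) : HasDerivAt Real.tanh (1 / Real.cosh x ^ 2) x := by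
  have h := (Real.hasDerivAt_sinh x).div (Real.hasDerivAt_cosh x) (Real.cosh_pos x).ne'
  rw [show Real.tanh = Real.sinh / Real.cosh from funext Real.tanh_eq_sinh_div_cosh]
  rwa [← sq, ← sq, Real.cosh_sq_sub_sinh_sq] at h

theorem strictConcaveOn_tanh : StrictConcaveOn ℝ (Set.Ici 0) Real.tanh := by
  refine StrictAntiOn.strictConcaveOn_of_deriv (convex_Ici 0)
    (continuous_iff_continuousAt.2 fun x => (hasDerivAt_tanh x).continuousAt).continuousOn ?_
  intro x hx y hy hxy
  rw [interior_Ici, Set.mem_Ioi] at hx hy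
  rw [(hasDerivAt_tanh x).deriv, (hasDerivAt_tanh y).deriv]
  have h := Real.cosh_lt_cosh.2 (by rwa [abs_of_pos hx, abs_of_pos hy] : |x| < |y|)
  have h0 := Real.cosh_pos x
  gcongr

theorem hasDerivAt_phiI (β x : ℝ) :
    HasDerivAt (phiI β) (β * (Real.tanh (β * x) - x)) x := by
  have h1 : HasDerivAt (fun x => β * x) β x := by simpa using (hasDerivAt_id x).const_mul β
  have h2 := (h1.cosh.log (Real.cosh_pos _).ne').sub (((hasDerivAt_id x).pow 2).const_mul (β / 2))
  refine h2.congr_deriv ?_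
  rw [Real.tanh_eq_sinh_div_cosh]
  simp
  ring

theorem continuous_phiI (β : ℝ) : Continuous (phiI β) :=
  continuous_iff_continuousAt.2 fun x => (hasDerivAt_phiI β x).continuousAt

theorem phiI_neg (β x : ℝ) : phiI β (-x) = phiI β x := by
  simp [phiI]

variable {β : ℝ}

/-- The chord of `tanh` from `0` to `β * y` has height `x` at `β * x`; strict concavity puts `tanh
(β * x)` above it, so the derivative is positive on `(0, y)`. A positive critical point thus
excludes any maximizer to its left. -/
theorem strictMonoOn_phiI_of_tanh_eq (hβ : 0 < β) {y : ℝ} (hy : 0 < y)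
    (h : Real.tanh (β * y) = y) : StrictMonoOn (phiI β) (Set.Icc 0 y) := by
  refine strictMonoOn_of_deriv_pos (convex_Icc 0 y) (continuous_phiI β).continuousOn fun x hx => ?_
  rw [interior_Icc] at hx
  rw [(hasDerivAt_phiI β x).deriv]
  refine mul_pos hβ (sub_pos.2 ?_)
  have hc := strictConcaveOn_tanh.2 (Set.mem_Ici.2 le_rfl)
    (Set.mem_Ici.2 (mul_pos hβ hy).le) (mul_pos hβ hy).ne
    (sub_pos.2 ((div_lt_one hy).2 hx.2)) (div_pos hx.1 hy) (sub_add_cancel _ _)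
  simp only [smul_eq_mul, mul_zero, Real.tanh_zero, zero_add, h] at hc
  rwa [div_mul_cancel₀ _ hy.ne', mul_left_comm, div_mul_cancel₀ _ hy.ne'] at hc

theorem antitoneOn_phiI (hβ : 0 < β) : AntitoneOn (phiI β) (Set.Ici 1) := by
  refine antitoneOn_of_deriv_nonpos (convex_Ici 1) (continuous_phiI β).continuousOn
    (fun x _ => (hasDerivAt_phiI β x).differentiableAt.differentiableWithinAt) fun x hx => ?_
  rw [interior_Ici, Set.mem_Ioi] at hx
  rw [(hasDerivAt_phiI β x).deriv]
  exact mul_nonpos_of_nonneg_of_nonpos hβ.le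
    (sub_nonpos.2 ((Real.tanh_lt_one _).le.trans hx.le))

theorem lt_one_of_isMaxOn_phiI (hβ : 0 < β) {y : ℝ} (hy : y ∈ Set.Icc (0 : ℝ) 1)
    (hmax : IsMaxOn (phiI β) (Set.Icc 0 1) y) : y < 1 := by
  refine hy.2.lt_of_ne ?_
  rintro rfl
  -- The derivative at the endpoint is negative, so values slightly to the left of `1` are larger.
  have hneg : β * (Real.tanh (β * 1) - 1) < 0 :=
    mul_neg_of_pos_of_neg hβ (sub_neg.2 (Real.tanh_lt_one _))
  have h := (hasDerivAt_phiI β 1).tendsto_slope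
  have h1 : ∀ᶠ x in 𝓝[<] (1 : ℝ), slope (phiI β) 1 x < 0 :=
    (h.mono_left (nhdsWithin_mono _ fun x hx => ne_of_lt hx)).eventually (gt_mem_nhds hneg)
  have h2 : ∀ᶠ x in 𝓝[<] (1 : ℝ), x ∈ Set.Ioo (0 : ℝ) 1 := Ioo_mem_nhdsLT one_pos
  obtain ⟨x, hx1, hx2⟩ := (h1.and h2).exists
  rw [slope_def_field] at hx1
  refine hx1.not_ge (div_nonneg_of_nonpos (sub_nonpos.2 ?_) (sub_nonpos.2 hx2.2.le))
  exact hmax ⟨hx2.1.le, hx2.2.le⟩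

theorem tanh_eq_of_isMaxOn_phiI (hβ : 0 < β) {y : ℝ} (hy : y ∈ Set.Icc (0 : ℝ) 1) (hy0 : 0 < y)
    (hmax : IsMaxOn (phiI β) (Set.Icc 0 1) y) : Real.tanh (β * y) = y := by
  have hloc := hmax.isLocalMax (Icc_mem_nhds hy0 (lt_one_of_isMaxOn_phiI hβ hy hmax))
  have h := hloc.hasDerivAt_eq_zero (hasDerivAt_phiI β y)
  exact sub_eq_zero.1 ((mul_eq_zero.1 h).resolve_left hβ.ne')

theorem eq_of_isMaxOn_phiI (hβ : 0 < β) {y z : ℝ} (hy : y ∈ Set.Icc (0 : ℝ) 1)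
    (hz : z ∈ Set.Icc (0 : ℝ) 1) (hymax : IsMaxOn (phiI β) (Set.Icc 0 1) y)
    (hzmax : IsMaxOn (phiI β) (Set.Icc 0 1) z) : y = z := by
  have key : ∀ {y z : ℝ}, y ∈ Set.Icc (0 : ℝ) 1 → z ∈ Set.Icc (0 : ℝ) 1 →
      IsMaxOn (phiI β) (Set.Icc 0 1) y → IsMaxOn (phiI β) (Set.Icc 0 1) z → ¬ y < z := by
    intro y z hy hz hymax hzmax hlt
    have hz0 : 0 < z := hy.1.trans_lt hlt
    exact (hymax hz).not_gt (strictMonoOn_phiI_of_tanh_eq hβ hz0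
      (tanh_eq_of_isMaxOn_phiI hβ hz hz0 hzmax) ⟨hy.1, hlt.le⟩ ⟨hz0.le, le_rfl⟩ hlt)
  exact le_antisymm (not_lt.1 (key hz hy hzmax hymax)) (not_lt.1 (key hy hz hymax hzmax))

theorem exists_isMaxOn_phiI (β : ℝ) :
    ∃ ξ ∈ Set.Icc (0 : ℝ) 1, IsMaxOn (phiI β) (Set.Icc 0 1) ξ :=
  isCompact_Icc.exists_isMaxOn (Set.nonempty_Icc.2 zero_le_one) (continuous_phiI β).continuousOn

theorem isMaxOn_phiI_zero (hβ : 0 < β) (hβ1 : β ≤ 1) : IsMaxOn (phiI β) (Set.Icc 0 1) 0 := by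
  intro x _
  have h := Real.log_le_log (Real.cosh_pos _) (Real.cosh_le_exp_half_sq (β * x))
  rw [Real.log_exp] at h
  have h2 : 0 ≤ β * (1 - β) * x ^ 2 :=
    mul_nonneg (mul_nonneg hβ.le (sub_nonneg.2 hβ1)) (sq_nonneg x)
  simp only [phiI, Set.mem_ofPred_eq, mul_zero, Real.cosh_zero, Real.log_one]
  nlinarith

theorem phiI_le (hβ : 0 < β) (x : ℝ) : phiI β x ≤ β - β / 4 * x ^ 2 := by
  have h1 : Real.cosh (β * x) ≤ Real.exp |β * x| := by
    rw [← Real.cosh_abs, Real.cosh_eq]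
    have := Real.exp_le_exp.2 (neg_le_self (abs_nonneg (β * x)))
    linarith
  have h := Real.log_le_log (Real.cosh_pos _) h1
  rw [Real.log_exp, abs_mul, abs_of_pos hβ] at h
  -- Expanded, this is `β |x| ≤ β + β x² / 4`, which absorbs the linear bound on `log cosh` into
  -- half of the quadratic term.
  have h2 : 0 ≤ β * (|x| / 2 - 1) ^ 2 := by positivity
  have h3 := sq_abs x
  simp only [phiI]
  nlinarith

theorem integrable_exp_phiI (hβ : 0 < β) : Integrable fun x => Real.exp (phiI β x) := by
  refine ((integrable_exp_neg_mul_sq (show 0 < β / 4 by positivity)).const_mul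
    (Real.exp β)).mono' (Real.continuous_exp.comp (continuous_phiI β)).aestronglyMeasurable
    (Eventually.of_forall fun x => ?_)
  rw [Real.norm_of_nonneg (Real.exp_pos _).le, ← Real.exp_add, Real.exp_le_exp]
  linarith [phiI_le hβ x]

end RateFunction

/-! ### Laplace's method on the half-line -/

section Laplace

variable {c : ℝ → ℝ}

theorem integrableOn_pow_mul (hc : Continuous c) (hpos : ∀ x, 0 < c x)
    {s : Set ℝ} (hs : MeasurableSet s) (hint : IntegrableOn c s) {C : ℝ} (hC : ∀ x ∈ s, c x ≤ C)
    {G : ℝ → ℝ} (hG : Continuous G) {K : ℝ} (hK : ∀ x, |G x| ≤ K) {n : ℕ} (hn : n ≠ 0) :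
    IntegrableOn (fun x => c x ^ n * G x) s := by
  obtain ⟨m, rfl⟩ := Nat.exists_eq_succ_of_ne_zero hn
  refine (hint.const_mul (C ^ m * K)).mono' (by fun_prop)
    ((ae_restrict_iff' hs).2 (Eventually.of_forall fun x hx => ?_))
  have h1 : c x ^ m ≤ C ^ m := pow_le_pow_left₀ (hpos x).le (hC x hx) m
  have hK0 : 0 ≤ K := (abs_nonneg _).trans (hK x)
  rw [Real.norm_eq_abs, abs_mul, abs_of_pos (pow_pos (hpos x) _), Nat.succ_eq_add_one, pow_succ]
  calc c x ^ m * c x * |G x| ≤ C ^ m * c x * K := by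
        gcongr
        · exact mul_nonneg ((pow_pos (hpos x) m).le.trans h1) (hpos x).le
        · exact (hpos x).le
        · exact hK x
    _ = C ^ m * K * c x := by ring

/-- For `r` strictly between `c 1` and `c ξ`, the denominator is at least a constant times `r ^ n`,
while the tail is at most a constant times `c 1 ^ n`: the ratio decays geometrically. -/
theorem tendsto_setIntegral_tail_div (hc : Continuous c) (hpos : ∀ x, 0 < c x)
    (hint : IntegrableOn c (Set.Ioi 1)) {ξ : ℝ} (hξ : ξ ∈ Set.Ico (0 : ℝ) 1)
    (hlt : c 1 < c ξ) (htail : ∀ x, 1 < x → c x ≤ c 1) :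
    Tendsto (fun n : ℕ => (∫ x in Set.Ioi 1, c x ^ n) / ∫ x in Set.Icc 0 1, c x ^ n)
      atTop (𝓝 0) := by
  obtain ⟨r, hr1, hrξ⟩ := exists_between hlt
  have hr0 : 0 < r := (hpos 1).trans hr1
  -- A right neighbourhood, because `ξ` may be the endpoint `0`.
  have hev : ∀ᶠ x in 𝓝[≥] ξ, r < c x :=
    (hc.continuousAt.eventually (lt_mem_nhds hrξ)).filter_mono nhdsWithin_le_nhds
  obtain ⟨u, hu, hsub⟩ := mem_nhdsGE_iff_exists_Icc_subset.1
    (inter_mem hev (Icc_mem_nhdsGE hξ.2))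
  have hu' : ξ < u := hu
  have hlower : ∀ n : ℕ, (u - ξ) * r ^ n ≤ ∫ x in Set.Icc 0 1, c x ^ n := fun n => by
    have hcn : ∀ a b : ℝ, IntegrableOn (fun x => c x ^ n) (Set.Icc a b) := fun a b =>
      (hc.pow n).continuousOn.integrableOn_Icc
    calc (u - ξ) * r ^ n = ∫ _x in Set.Icc ξ u, r ^ n := by
          simp [hu'.le]
      _ ≤ ∫ x in Set.Icc ξ u, c x ^ n :=
          setIntegral_mono_on (by simp) (hcn _ _) measurableSet_Icc
            fun x hx => pow_le_pow_left₀ hr0.le (hsub hx).1.le n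
      _ ≤ ∫ x in Set.Icc 0 1, c x ^ n :=
          setIntegral_mono_set (hcn _ _) (Eventually.of_forall fun x => (pow_pos (hpos x) n).le)
            (LE.le.eventuallyLE fun x hx =>
              ⟨hξ.1.trans hx.1, (hsub hx).2.2⟩)
  -- One factor `c x` is kept for integrability; the other `n` are bounded by `c 1`.
  have hupper : ∀ n : ℕ, ∫ x in Set.Ioi 1, c x ^ (n + 1) ≤ c 1 ^ n * ∫ x in Set.Ioi 1, c x :=
    fun n => by
    rw [← integral_const_mul]
    refine setIntegral_mono_on ?_ (hint.const_mul _) measurableSet_Ioi fun x hx => ?_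
    · simpa using integrableOn_pow_mul hc hpos measurableSet_Ioi hint htail
        (continuous_const (y := (1 : ℝ))) (K := 1) (by simp) n.succ_ne_zero
    · rw [pow_succ]
      exact mul_le_mul_of_nonneg_right (pow_le_pow_left₀ (hpos x).le (htail x hx) n) (hpos x).le
  have hnn : ∀ n : ℕ, 0 ≤ ∫ x in Set.Ioi 1, c x ^ n := fun n =>
    integral_nonneg fun x => (pow_pos (hpos x) n).le
  rw [← tendsto_add_atTop_iff_nat 1]
  have hδ : 0 < u - ξ := sub_pos.2 hu'
  refine squeeze_zero (g := fun n : ℕ => (c 1 / r) ^ n * ((∫ x in Set.Ioi 1, c x) / ((u - ξ) * r)))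
    (fun n => div_nonneg (hnn _) ((by positivity : 0 ≤ (u - ξ) * r ^ (n + 1)).trans (hlower _)))
    (fun n => ?_) ?_
  · calc _ ≤ (c 1 ^ n * ∫ x in Set.Ioi 1, c x) / ((u - ξ) * r ^ (n + 1)) :=
          div_le_div₀ ((hnn _).trans (hupper n)) (hupper n) (by positivity) (hlower _)
      _ = _ := by
        rw [div_pow, pow_succ]
        field_simp
  · have h := tendsto_pow_atTop_nhds_zero_of_lt_one (div_nonneg (hpos 1).le hr0.le)
      ((div_lt_one hr0).2 hr1)
    simpa using h.mul_const ((∫ x in Set.Ioi 1, c x) / ((u - ξ) * r))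

/-- Laplace's method for a weight on the half-line with a unique maximum in `[0, 1)`. -/
theorem tendsto_integral_pow_mul_div (hc : Continuous c) (hpos : ∀ x, 0 < c x)
    (hint : IntegrableOn c (Set.Ioi 0)) {ξ : ℝ} (hξ : ξ ∈ Set.Ico (0 : ℝ) 1)
    (hmax : ∀ x ∈ Set.Icc (0 : ℝ) 1, x ≠ ξ → c x < c ξ) (htail : ∀ x, 1 < x → c x ≤ c 1)
    {G : ℝ → ℝ} (hG : Continuous G) {K : ℝ} (hK : ∀ x, |G x| ≤ K) :
    Tendsto (fun n : ℕ => (∫ x in Set.Ioi 0, c x ^ n * G x) / ∫ x in Set.Ioi 0, c x ^ n)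
      atTop (𝓝 (G ξ)) := by
  have hlt : c 1 < c ξ := hmax 1 ⟨zero_le_one, le_rfl⟩ hξ.2.ne'
  have hint1 : IntegrableOn c (Set.Ioi 1) := hint.mono_set (Set.Ioi_subset_Ioi zero_le_one)
  have hT := tendsto_setIntegral_tail_div hc hpos hint1 hξ hlt htail
  have hJ : Tendsto (fun n : ℕ => (∫ x in Set.Icc 0 1, c x ^ n)⁻¹ •
      ∫ x in Set.Icc 0 1, c x ^ n • G x) atTop (𝓝 (G ξ)) :=
    tendsto_setIntegral_pow_smul_of_unique_maximum_of_isCompact_of_continuousOn isCompact_Icc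
      hc.continuousOn hmax (fun x _ => (hpos x).le) (hpos ξ)
      (by rw [interior_Icc, closure_Ioo zero_ne_one]; exact ⟨hξ.1, hξ.2.le⟩) hG.continuousOn
  have hS : Tendsto (fun n : ℕ => (∫ x in Set.Ioi 1, c x ^ n * G x) /
      ∫ x in Set.Icc 0 1, c x ^ n) atTop (𝓝 0) := by
    refine squeeze_zero_norm' ?_ (by simpa using hT.const_mul K)
    filter_upwards [eventually_ne_atTop 0] with n hn
    have hI : 0 ≤ ∫ x in Set.Icc 0 1, c x ^ n := integral_nonneg fun x => (pow_pos (hpos x) n).le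
    rw [norm_div, Real.norm_of_nonneg hI, mul_div_assoc']
    refine div_le_div_of_nonneg_right ?_ hI
    rw [← integral_const_mul]
    refine norm_integral_le_of_norm_le ?_ (Eventually.of_forall fun x => ?_)
    · have := integrableOn_pow_mul hc hpos measurableSet_Ioi hint1 htail
        (continuous_const (y := (1 : ℝ))) (K := 1) (by simp) hn
      simp only [mul_one] at this
      exact this.const_mul K
    · rw [norm_mul, Real.norm_of_nonneg (pow_pos (hpos x) n).le, mul_comm]
      exact mul_le_mul_of_nonneg_right (hK x) (pow_pos (hpos x) n).le
  -- Numerator and denominator are both divided by the integral over `[0, 1]`; the two tails then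
  -- tend to `0`.
  have hfin := (hJ.add hS).div (hT.const_add 1) (by norm_num)
  simp only [add_zero, div_one] at hfin
  refine hfin.congr' ?_
  filter_upwards [eventually_ne_atTop 0] with n hn
  have hsplit : ∀ (F : ℝ → ℝ), IntegrableOn F (Set.Icc 0 1) → IntegrableOn F (Set.Ioi 1) →
      ∫ x in Set.Ioi 0, F x = (∫ x in Set.Icc 0 1, F x) + ∫ x in Set.Ioi 1, F x := by
    intro F h1 h2
    rw [integral_Icc_eq_integral_Ioc, ← setIntegral_union Set.Ioc_disjoint_Ioi_same
      measurableSet_Ioi (h1.mono_set Set.Ioc_subset_Icc_self) h2,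
      Set.Ioc_union_Ioi_eq_Ioi zero_le_one]
  have hone := integrableOn_pow_mul hc hpos measurableSet_Ioi hint1 htail
    (continuous_const (y := (1 : ℝ))) (K := 1) (by simp) hn
  simp only [mul_one] at hone
  rw [hsplit (fun x => c x ^ n * G x) ((hc.pow n).mul hG).continuousOn.integrableOn_Icc
      (integrableOn_pow_mul hc hpos measurableSet_Ioi hint1 htail hG hK hn),
    hsplit (fun x => c x ^ n) (hc.pow n).continuousOn.integrableOn_Icc hone]
  have hIpos : 0 < ∫ x in Set.Icc 0 1, c x ^ n := by
    rw [integral_Icc_eq_integral_Ioc, ← intervalIntegral.integral_of_le zero_le_one]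
    exact intervalIntegral.intervalIntegral_pos_of_pos ((hc.pow n).intervalIntegrable _ _)
      (fun x => pow_pos (hpos x) n) one_pos
  simp only [Pi.div_apply, smul_eq_mul]
  rw [← div_eq_inv_mul, ← add_div, one_add_div hIpos.ne', div_div_div_cancel_right₀ hIpos.ne']

end Laplace

/-! ### The Gibbs measure as a mixture of Bernoulli measures -/

section Mixture

theorem integrable_exp_quadratic {a : ℝ} (ha : 0 < a) (m : ℝ) :
    Integrable fun x : ℝ => Real.exp (-a * (x - m) ^ 2) :=
  (integrable_exp_neg_mul_sq ha).comp_sub_right m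

theorem integral_exp_quadratic (a m : ℝ) :
    ∫ x : ℝ, Real.exp (-a * (x - m) ^ 2) = √(Real.pi / a) := by
  rw [integral_sub_right_eq_self (fun x => Real.exp (-a * x ^ 2)) m, integral_gaussian]

/-- Completing the square in `x`: with total spin `S`, the maximum is at `x = S / n` and leaves `β
S² / (2n)`, which is minus `β` times the energy. -/
theorem neg_mul_hamiltonian {n : ℕ} (hn : n ≠ 0) (β x : ℝ) (v : Fin n → ℤˣ) :
    ∑ i, β * x * ((v i : ℤ) : ℝ) - n * (β / 2 * x ^ 2) =
      -β * hamiltonian v +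
        -(n * β / 2) * (x - (∑ i, ((v i : ℤ) : ℝ)) / n) ^ 2 := by
  have hn' : (n : ℝ) ≠ 0 := Nat.cast_ne_zero.2 hn
  rw [hamiltonian, ← Finset.mul_sum]
  simp_rw [← Finset.sum_mul]
  rw [← Finset.mul_sum]
  field_simp
  ring

/-- The factor `cosh (β x) ^ n` in `exp (phiI β x) ^ n` cancels the normalization `(2 cosh (β x)) ^
n` of the product weights, up to `2 ^ n`. -/
theorem exp_phiI_pow_mul_prod (β x : ℝ) {n : ℕ} (hn : n ≠ 0) (v : Fin n → ℤˣ) :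
    2 ^ n * (Real.exp (phiI β x) ^ n * ∏ i, spinWeight (β * x) (v i)) =
      Real.exp (-β * hamiltonian v) *
        Real.exp (-(n * β / 2) * (x - (∑ i, ((v i : ℤ) : ℝ)) / n) ^ 2) := by
  rw [← Real.exp_add, ← neg_mul_hamiltonian hn, Real.exp_sub, Real.exp_sum, phiI, Real.exp_sub,
    Real.exp_log (Real.cosh_pos _), Real.exp_nat_mul]
  simp only [spinWeight, Finset.prod_div_distrib, Finset.prod_const, Finset.card_univ,
    Fintype.card_fin, Real.cosh_eq]
  have h : Real.exp (β * x) + Real.exp (-(β * x)) ≠ 0 := by positivity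
  rw [div_pow, div_pow]
  field_simp

theorem bernoulli_real_pre_preimage (b : ℝ) {n : ℕ} (s : Finset (Fin n → ℤˣ)) :
    (bernoulli b : Measure Shift).real (pre n ⁻¹' s) = ∑ v ∈ s, ∏ i, spinWeight b (v i) := by
  rw [← sum_measureReal_preimage_singleton _ fun a _ => hasMeasurableFibers_pre n a]
  exact Finset.sum_congr rfl fun v _ => bernoulli_real_pre b n v

theorem continuous_bernoulli_real_pre_preimage {n : ℕ} (B : Set (Fin n → ℤˣ)) :
    Continuous fun b => (bernoulli b : Measure Shift).real (pre n ⁻¹' B) := by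
  obtain ⟨s, rfl⟩ := B.toFinite.exists_finset_coe
  simp_rw [bernoulli_real_pre_preimage]
  refine continuous_finsetSum _ fun v _ => continuous_finsetProd _ fun i _ => ?_
  unfold spinWeight
  exact Continuous.div (by fun_prop) (by fun_prop) fun b => by positivity

/-- The Gaussian linearization of the quadratic interaction. -/
theorem sqrt_mul_sum_exp_hamiltonian {β : ℝ} (hβ : 0 < β) {n : ℕ} (hn : n ≠ 0)
    (s : Finset (Fin n → ℤˣ)) :
    √(Real.pi / (n * β / 2)) * ∑ v ∈ s, Real.exp (-β * hamiltonian v) =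
      2 ^ n * ∫ x, Real.exp (phiI β x) ^ n *
        (bernoulli (β * x) : Measure Shift).real (pre n ⁻¹' s) := by
  have hn' : (0 : ℝ) < n := Nat.cast_pos.2 (Nat.pos_of_ne_zero hn)
  rw [← integral_const_mul]
  simp_rw [bernoulli_real_pre_preimage, Finset.mul_sum, exp_phiI_pow_mul_prod β _ hn]
  rw [integral_finsetSum _ fun v _ =>
    (integrable_exp_quadratic (by positivity : 0 < n * β / 2) _).const_mul _]
  refine Finset.sum_congr rfl fun v _ => ?_
  rw [integral_const_mul, integral_exp_quadratic, mul_comm]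

theorem gibbs_real_pre (β : ℝ) (n : ℕ) (v : Fin n → ℤˣ) :
    (gibbs n β : Measure Shift).real (pre n ⁻¹' {v}) =
      Real.exp (-β * hamiltonian v) / ∑ v' : Fin n → ℤˣ, Real.exp (-β * hamiltonian v') := by
  have hm := hasMeasurableFibers_pre n v
  have hZ : 0 < ∑ v' : Fin n → ℤˣ, Real.exp (-β * hamiltonian v') :=
    Finset.sum_pos (fun _ _ => Real.exp_pos _) Finset.univ_nonempty
  change (gibbsAux n β).real _ = _
  rw [measureReal_def, gibbsAux, withDensity_apply _ hm,
    setLIntegral_congr_fun (g := fun _ => ENNReal.ofReal (Real.exp (-β * hamiltonian v) /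
      partitionFunction n β)) hm (fun x (hx : pre n x = v) => by simp only [hx]),
    setLIntegral_const, unif_pre, ENNReal.toReal_mul, ENNReal.toReal_ofReal, partitionFunction]
  · simp
    field_simp
  · unfold partitionFunction
    positivity

/-- The de Finetti form of the Gibbs measure on words of length `n`: linearize the sums over `B` and
over all words; the Gaussian constant and `2 ^ n` cancel in the quotient. -/
theorem gibbs_real_pre_preimage {β : ℝ} (hβ : 0 < β) {n : ℕ} (hn : n ≠ 0)
    (B : Set (Fin n → ℤˣ)) :
    (gibbs n β : Measure Shift).real (pre n ⁻¹' B) =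
      (∫ x, Real.exp (phiI β x) ^ n * (bernoulli (β * x) : Measure Shift).real (pre n ⁻¹' B)) /
        ∫ x, Real.exp (phiI β x) ^ n := by
  obtain ⟨s, rfl⟩ := B.toFinite.exists_finset_coe
  have hn' : (0 : ℝ) < n := Nat.cast_pos.2 (Nat.pos_of_ne_zero hn)
  have hκ : √(Real.pi / (n * β / 2)) ≠ 0 := by positivity
  have h1 := sqrt_mul_sum_exp_hamiltonian hβ hn s
  have h2 := sqrt_mul_sum_exp_hamiltonian hβ hn Finset.univ
  simp only [Finset.coe_univ, Set.preimage_univ, probReal_univ, mul_one] at h2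
  rw [← sum_measureReal_preimage_singleton _ fun a _ => hasMeasurableFibers_pre n a]
  simp_rw [gibbs_real_pre]
  rw [← Finset.sum_div, ← mul_div_mul_left _ _ hκ, h1, h2, mul_div_mul_left _ _ (by positivity)]

theorem integral_eq_integral_Ioi_add_neg {F : ℝ → ℝ} (hF : Integrable F) :
    ∫ x, F x = ∫ x in Set.Ioi 0, (F x + F (-x)) := by
  rw [integral_add hF.integrableOn hF.comp_neg.integrableOn, integral_comp_neg_Ioi, neg_zero,
    add_comm]
  exact (intervalIntegral.integral_Iic_add_Ioi hF.integrableOn hF.integrableOn).symm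

theorem halfSum_real (μ ν : ProbabilityMeasure Shift) (A : Set Shift) :
    (halfSum μ ν : Measure Shift).real A =
      ((μ : Measure Shift).real A + (ν : Measure Shift).real A) / 2 := by
  change ((2⁻¹ : ℝ≥0∞) • ((μ : Measure Shift) + (ν : Measure Shift))).real A = _
  rw [measureReal_ennreal_smul_apply, measureReal_add_apply]
  simp
  ring

theorem halfSum_self (μ : ProbabilityMeasure Shift) : halfSum μ μ = μ := by
  refine ProbabilityMeasure.toMeasure_injective (Measure.ext fun A _ => ?_)
  rw [← measureReal_eq_measureReal_iff, halfSum_real]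
  ring

/-- Since `phiI` is even, folding the mixture replaces the Bernoulli mass at `x` by its average over
`x` and `-x`. On the half-line `ξ` is the only maximizer, so Laplace's method applies. -/
theorem tendsto_gibbs_real_pre_preimage {β : ℝ} (hβ : 0 < β) {ξ : ℝ} (hξ : ξ ∈ Set.Icc (0 : ℝ) 1)
    (hmax : IsMaxOn (phiI β) (Set.Icc 0 1) ξ) {N : ℕ} (B : Set (Fin N → ℤˣ)) :
    Tendsto (fun n => (gibbs n β : Measure Shift).real (pre N ⁻¹' B)) atTop
      (𝓝 ((halfSum (bernoulli (β * ξ)) (bernoulli (-(β * ξ))) : Measure Shift).real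
        (pre N ⁻¹' B))) := by
  set F : ℝ → ℝ := fun x => (bernoulli (β * x) : Measure Shift).real (pre N ⁻¹' B) with hF
  set c : ℝ → ℝ := fun x => Real.exp (phiI β x) with hc
  have hFc : Continuous F :=
    (continuous_bernoulli_real_pre_preimage B).comp (continuous_const.mul continuous_id)
  have hF1 : ∀ x, |F x| ≤ 1 := fun x => by
    rw [abs_of_nonneg measureReal_nonneg]
    exact measureReal_le_one
  have hcc : Continuous c := Real.continuous_exp.comp (continuous_phiI β)
  have hcpos : ∀ x, 0 < c x := fun x => Real.exp_pos _
  have hcint : Integrable c := integrable_exp_phiI hβ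
  have hcneg : ∀ x, c (-x) = c x := fun x => by simp only [hc, phiI_neg]
  have hcb : ∀ x ∈ Set.univ, c x ≤ Real.exp β := fun x _ =>
    Real.exp_le_exp.2 ((phiI_le hβ x).trans (sub_le_self _ (by positivity)))
  have hlap := tendsto_integral_pow_mul_div hcc hcpos hcint.integrableOn
    (ξ := ξ) ⟨hξ.1, lt_one_of_isMaxOn_phiI hβ hξ hmax⟩
    (fun x hx hne => (Real.exp_le_exp.2 (hmax hx)).lt_of_ne fun heq => hne
      (eq_of_isMaxOn_phiI hβ hx hξ (fun y hy => (hmax hy).trans_eq (Real.exp_injective heq).symm)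
        hmax))
    (fun x hx => Real.exp_le_exp.2 (antitoneOn_phiI hβ (Set.mem_Ici.2 le_rfl)
      (Set.mem_Ici.2 hx.le) hx.le))
    (G := fun x => (F x + F (-x)) / 2) (K := 1) (by fun_prop) (fun x => by
      have h1 := abs_le.1 (hF1 x)
      have h2 := abs_le.1 (hF1 (-x))
      exact abs_le.2 ⟨by linarith, by linarith⟩)
  have hlimit : (halfSum (bernoulli (β * ξ)) (bernoulli (-(β * ξ))) : Measure Shift).real
      (pre N ⁻¹' B) = (F ξ + F (-ξ)) / 2 := by
    rw [halfSum_real, hF]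
    simp only [mul_neg]
  rw [hlimit]
  refine hlap.congr' ?_
  filter_upwards [eventually_ge_atTop N, eventually_ne_atTop 0] with n hn hn0
  -- The mixture formula concerns words of length exactly `n`, so the event is re-read as one on the
  -- longer prefix.
  have hpre : pre N ⁻¹' B = pre n ⁻¹' {v | (fun i : Fin N => v (Fin.castLE hn i)) ∈ B} := rfl
  have hint : ∀ {G : ℝ → ℝ}, Continuous G → (∀ x, |G x| ≤ 1) →
      Integrable fun x => c x ^ n * G x := fun hG hG1 =>
    integrableOn_univ.1 (integrableOn_pow_mul hcc hcpos MeasurableSet.univ hcint.integrableOn hcb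
      hG hG1 hn0)
  have hone : Integrable fun x => c x ^ n := by
    simpa using hint (continuous_const (y := (1 : ℝ))) (by simp)
  have hmix := gibbs_real_pre_preimage hβ hn0 {v | (fun i : Fin N => v (Fin.castLE hn i)) ∈ B}
  rw [← hpre] at hmix
  rw [hmix]
  change _ = (∫ x, c x ^ n * F x) / ∫ x, c x ^ n
  rw [integral_eq_integral_Ioi_add_neg (hint hFc hF1), integral_eq_integral_Ioi_add_neg hone]
  simp only [hcneg, ← mul_add, ← two_mul, ← mul_div_assoc]
  rw [integral_const_mul, integral_div, div_div]

/-- Weak convergence of the Curie–Weiss Gibbs measures. -/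
theorem tendsto_gibbs {β : ℝ} (hβ : 0 < β) {ξ : ℝ} (hξ : ξ ∈ Set.Icc (0 : ℝ) 1)
    (hmax : IsMaxOn (phiI β) (Set.Icc 0 1) ξ) :
    Tendsto (fun n : ℕ => gibbs n β) atTop
      (𝓝 (halfSum (bernoulli (β * ξ)) (bernoulli (-(β * ξ))))) := by
  -- Cylinders form a π-system containing small neighbourhoods of every point, so convergence of
  -- their masses suffices.
  refine isPiSystem_measurableCylinders.tendsto_probabilityMeasure_of_tendsto_of_mem
    (S := measurableCylinders fun _ : ℕ => ℤˣ)
    (fun t ht => MeasurableSet.of_mem_measurableCylinders ht) (fun u hu x hx => ?_)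
    fun t ht => ?_
  · obtain ⟨I, v, hv, hsub⟩ := isOpen_pi_iff.1 hu x hx
    refine ⟨(I : Set ℕ).pi fun i => {x i}, ?_, ?_, ?_⟩
    · refine (mem_measurableCylinders _).2 ⟨I, {I.restrict x}, MeasurableSet.singleton _, ?_⟩
      ext y
      simp [cylinder, Set.mem_pi, funext_iff]
    · exact set_pi_mem_nhds I.finite_toSet fun i _ => (isOpen_discrete {x i}).mem_nhds rfl
    · exact (Set.pi_mono fun i hi => Set.singleton_subset_iff.2 (hv i hi).2).trans hsub
  · obtain ⟨M, hM⟩ := exists_forall_ge_eq_pre_preimage ht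
    obtain ⟨B, rfl⟩ := hM M le_rfl
    exact NNReal.tendsto_coe.1 (tendsto_gibbs_real_pre_preimage hβ hξ hmax B)

end Mixture

end CurieWeiss

theorem theorem1p1 (β : ℝ) (hβ : 0 < β) :
    ∃ ξ ∈ Set.Icc (0 : ℝ) 1,
      IsMaxOn (CurieWeiss.phiI β) (Set.Icc 0 1) ξ ∧
      (∀ y ∈ Set.Icc (0 : ℝ) 1, IsMaxOn (CurieWeiss.phiI β) (Set.Icc 0 1) y → y = ξ) ∧
      ∃ μt : ℝ → ProbabilityMeasure CurieWeiss.Shift,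
        (∀ b : ℝ, CurieWeiss.IsDynamicalGibbsMeasure (b • CurieWeiss.psi) (μt b)) ∧
        (∀ b : ℝ, μt b = CurieWeiss.bernoulli b) ∧
        μt 0 = CurieWeiss.unif ∧
        (β ≤ 1 → Tendsto (fun n : ℕ => CurieWeiss.gibbs n β) atTop (𝓝 (μt 0))) ∧
        (1 < β → Tendsto (fun n : ℕ => CurieWeiss.gibbs n β) atTop
          (𝓝 (CurieWeiss.halfSum (μt (β * ξ)) (μt (-(β * ξ)))))) := by
  obtain ⟨ξ, hξ, hmax⟩ := CurieWeiss.exists_isMaxOn_phiI β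
  refine ⟨ξ, hξ, hmax, fun y hy hymax => CurieWeiss.eq_of_isMaxOn_phiI hβ hy hξ hymax hmax,
    CurieWeiss.bernoulli, CurieWeiss.isDynamicalGibbsMeasure_bernoulli, fun _ => rfl,
    CurieWeiss.bernoulli_zero, fun hβ1 => ?_, fun _ => CurieWeiss.tendsto_gibbs hβ hξ hmax⟩
  -- The limit formula holds for every `β > 0`; here it is used with the maximizer `0`, where both
  -- halves are `bernoulli 0`.
  have h := CurieWeiss.tendsto_gibbs hβ (Set.left_mem_Icc.2 zero_le_one)
    (CurieWeiss.isMaxOn_phiI_zero hβ hβ1)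
  rwa [mul_zero, neg_zero, CurieWeiss.halfSum_self] at h
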